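/- Let $\mathcal K$ be a tensor triangulated category, i.e. a triangulated category $(\mathcal K,\Sigma)$ with a symmetric monoidal structure $(\otimes,\mathbb 1)$ which is exact in each variable, with suspension isomorphisms $\Sigma a\otimes b\simeq\Sigma(a\otimes b)$ and $a\otimes\Sigma b\simeq\Sigma(a\otimes b)$ compatible with the symmetry, unitors and associators and such that the two resulting isomorphisms $\Sigma a\otimes\Sigma b\simeq\Sigma^2(a\otimes b)$ differ by the sign $-1$. For an object $X$ let $E_X=\{f\in\operatorname{End}_{\mathcal K}(X)\mid f\otimes X=X\otimes f \text{ in } \operatorname{End}_{\mathcal K}(X\otimes X)\}$, a ring under addition and composition. For a non-empty family $\Phi$ of objects closed under $\otimes$, let $R_\Phi$ be the quotient of the set of pairs $(Z,f)$ with $Z\in\Phi$, $f\in E_Z$, by the smallest equivalence relation such that $(Z,f)\sim(a\otimes Z,a\otimes f)$ and $(Z,f)\sim(Z\otimes a,f\otimes a)$ for all $a\in\Phi$. It is a commutative ring with $[f_Z]+[g_W]=[f\otimes W+Z\otimes g]$ and $[f_Z]\cdot[g_W]=[(f\otimes W)\circ(Z\otimes g)]$. Endomorphisms that correspond under an isomorphism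 between objects of $\Phi$ have the same class in $R_\Phi$. Let $R_X:=R_\Phi$ for $\Phi=\{X^{\otimes n}\mid n\ge 1\}$ (taken up to isomorphism). Let $\operatorname{Spc}(\mathcal K)$ be the set of prime ideals of $\mathcal K$, that is, of proper thick $\otimes$-ideals $\mathcal P$ such that $a\otimes b\in\mathcal P$ implies $a\in\mathcal P$ or $b\in\mathcal P$; let $\operatorname{supp}(X)=\{\mathcal P\mid X\notin\mathcal P\}$, and let $\rho_X:\operatorname{supp}(X)\to\operatorname{Spec}(R_X)$ be the comparison map $\rho_X(\mathcal P)=\{[f]\in R_X\mid \operatorname{cone}(f)\notin\mathcal P\}$. **Proposition.** For all objects $X,Y$ of $\mathcal K$ and every integer $k\ge 1$, tensoring on the left by $X^{\otimes(k-1)}$ induces an isomorphism of rings $$\varphi: R_{X\otimes Y}\xrightarrow{\ \sim\ }R_{X^{\otimes k}\otimes Y};$$ explicitly, for every $n\ge1$ and $f\in E_{(X\otimes Y)^{\otimes n}}$, $\varphi([f])$ is the class of $(X^{\otimes(k-1)})^{\otimes n}\otimes f$, an endomorphism of $(X^{\otimes(k-1)})^{\otimes n}\otimes(X\otimes Y)^{\otimes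 n}\simeq(X^{\otimes k}\otimes Y)^{\otimes n}$. Under this identification $\rho_{X\otimes Y}$ and $\rho_{X^{\otimes k}\otimes Y}$ coincide: $\operatorname{supp}(X\otimes Y)=\operatorname{supp}(X^{\otimes k}\otimes Y)$, and $\rho_{X\otimes Y}(\mathcal P)=\varphi^{-1}\big(\rho_{X^{\otimes k}\otimes Y}(\mathcal P)\big)$ for every $\mathcal P$ in this set. -/

import Mathlib

open CategoryTheory CategoryTheory.MonoidalCategory CategoryTheory.Limits
  CategoryTheory.Pretriangulated

universe v u

namespace TTGeometry

/-! ### Tensor-balanced endomorphisms -/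

section Balanced

variable {C : Type u} [Category.{v} C] [MonoidalCategory C]

/-- An endomorphism `f : X ⟶ X` is `⊗`-balanced if `f ⊗ X = X ⊗ f` as endomorphisms
of `X ⊗ X`. -/
def IsBalanced {X : C} (f : X ⟶ X) : Prop := f ▷ X = X ◁ f

lemma IsBalanced.of_iso {X Y : C} {f : X ⟶ X} (hf : IsBalanced f) {g : Y ⟶ Y} (e : X ≅ Y)
    (h : f ≫ e.hom = e.hom ≫ g) : IsBalanced g := by
  have hb : f ▷ X = X ◁ f := hf
  have h1 : (e.hom ⊗ₘ e.hom) ≫ g ▷ Y = f ▷ X ≫ (e.hom ⊗ₘ e.hom) := by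
    rw [tensorHom_def', Category.assoc, ← comp_whiskerRight, ← h, comp_whiskerRight,
      whisker_exchange_assoc]
  have h2 : (e.hom ⊗ₘ e.hom) ≫ Y ◁ g = X ◁ f ≫ (e.hom ⊗ₘ e.hom) := by
    rw [MonoidalCategory.tensorHom_def, Category.assoc, ← MonoidalCategory.whiskerLeft_comp, ← h,
      MonoidalCategory.whiskerLeft_comp, whisker_exchange_assoc]
  show _ = _
  rw [← cancel_epi (e.hom ⊗ₘ e.hom), h1, h2, hb]

lemma IsBalanced.whiskerRight_eq {X : C} {f : X ⟶ X} (hf : IsBalanced f) (W : C) :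
    f ▷ (X ⊗ W) = X ◁ (f ▷ W) := by
  have hf' : f ▷ X = X ◁ f := hf
  rw [MonoidalCategory.whiskerRight_tensor, hf']
  simp

lemma whiskerRight_sq_tensor [Preadditive C] [MonoidalPreadditive C] {X A : C} {f : X ⟶ X} (h : f ▷ A ≫ f ▷ A = 0) (B : C) :
    f ▷ (A ⊗ B) ≫ f ▷ (A ⊗ B) = 0 := by
  rw [MonoidalCategory.whiskerRight_tensor]
  simp only [Category.assoc, Iso.hom_inv_id_assoc]
  rw [← comp_whiskerRight_assoc, h]
  simp

/-- The ring `E_X` of `⊗`-balanced endomorphisms of `X`. -/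
def balancedEnd [Preadditive C] [MonoidalPreadditive C] (X : C) : Subring (End X) where
  carrier := {f | IsBalanced f}
  mul_mem' {f g} hf hg := by
    have hf' : f ▷ X = X ◁ f := hf
    have hg' : g ▷ X = X ◁ g := hg
    show (g ≫ f) ▷ X = X ◁ (g ≫ f)
    rw [comp_whiskerRight, MonoidalCategory.whiskerLeft_comp, hf', hg']
  one_mem' := by
    show (𝟙 X) ▷ X = X ◁ (𝟙 X)
    simp
  add_mem' {f g} hf hg := by
    have hf' : f ▷ X = X ◁ f := hf
    have hg' : g ▷ X = X ◁ g := hg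
    show (f + g) ▷ X = X ◁ (f + g)
    rw [MonoidalPreadditive.add_whiskerRight, MonoidalPreadditive.whiskerLeft_add, hf', hg']
  zero_mem' := by
    show (0 : X ⟶ X) ▷ X = X ◁ (0 : X ⟶ X)
    simp
  neg_mem' {f} hf := by
    have hf' : f ▷ X = X ◁ f := hf
    show (-f) ▷ X = X ◁ (-f)
    have h1 : (-f) ▷ X = -(f ▷ X) := (tensorRight X).map_neg
    have h2 : X ◁ (-f) = -(X ◁ f) := (tensorLeft X).map_neg
    rw [h1, h2, hf']

/-- The underlying morphism of an element of `E_X`. -/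
def toHom [Preadditive C] [MonoidalPreadditive C] {X : C} (f : balancedEnd X) : X ⟶ X := f.1

variable [SymmetricCategory C]

lemma IsBalanced.whiskerRight_tensor {X : C} {f : X ⟶ X} (hf : IsBalanced f) (c : C) :
    f ▷ (c ⊗ X) = X ◁ (c ◁ f) := by
  let s : X ⊗ (c ⊗ X) ≅ c ⊗ (X ⊗ X) :=
    (α_ X c X).symm ≪≫ whiskerRightIso (β_ X c) X ≪≫ α_ c X X
  have h1 : f ▷ (c ⊗ X) ≫ s.hom = s.hom ≫ c ◁ (f ▷ X) := by
    simp only [s, Iso.trans_hom, Iso.symm_hom, whiskerRightIso_hom, Category.assoc]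
    rw [← associator_naturality_middle, ← comp_whiskerRight_assoc,
      ← BraidedCategory.braiding_naturality_left, comp_whiskerRight_assoc,
      associator_inv_naturality_left_assoc]
  have h2 : X ◁ (c ◁ f) ≫ s.hom = s.hom ≫ c ◁ (X ◁ f) := by
    simp only [s, Iso.trans_hom, Iso.symm_hom, whiskerRightIso_hom, Category.assoc]
    rw [associator_inv_naturality_right_assoc, whisker_exchange_assoc,
      associator_naturality_right]
  have h3 : f ▷ X = X ◁ f := hf
  rw [← cancel_mono s.hom, h1, h2, h3]

lemma IsBalanced.whiskerLeft {X : C} {f : X ⟶ X} (hf : IsBalanced f) (a : C) :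
    IsBalanced (a ◁ f) := by
  have h := hf.whiskerRight_tensor a
  calc (a ◁ f) ▷ (a ⊗ X) = (α_ a X (a ⊗ X)).hom ≫ a ◁ (f ▷ (a ⊗ X)) ≫
        (α_ a X (a ⊗ X)).inv := by simp only [whisker_assoc]
    _ = (a ⊗ X) ◁ (a ◁ f) := by rw [h, ← tensor_whiskerLeft]

lemma IsBalanced.whiskerRight {X : C} {f : X ⟶ X} (hf : IsBalanced f) (a : C) :
    IsBalanced (f ▷ a) := by
  have h := hf.whiskerRight_tensor a
  calc (f ▷ a) ▷ (X ⊗ a) = 𝟙 _ ⊗≫ (f ▷ (a ⊗ X)) ▷ a ⊗≫ 𝟙 _ := by monoidal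
    _ = 𝟙 _ ⊗≫ (X ◁ (a ◁ f)) ▷ a ⊗≫ 𝟙 _ := by rw [h]
    _ = (X ⊗ a) ◁ (f ▷ a) := by monoidal

variable [Preadditive C] [MonoidalPreadditive C]

/-- The map `a ⊗ - : E_X → E_{a ⊗ X}`. -/
def tensorOnLeft (a : C) {X : C} (f : balancedEnd X) : balancedEnd (a ⊗ X) :=
  ⟨a ◁ toHom f, f.2.whiskerLeft a⟩

/-- The map `- ⊗ a : E_X → E_{X ⊗ a}`. -/
def tensorOnRight {X : C} (f : balancedEnd X) (a : C) : balancedEnd (X ⊗ a) :=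
  ⟨toHom f ▷ a, f.2.whiskerRight a⟩

end Balanced

/-! ### The ring `R_Φ` of a `⊗`-multiplicative family of objects -/

section Ring

variable {C : Type u} [Category.{v} C] [MonoidalCategory C] [SymmetricCategory C]
  [Preadditive C] [MonoidalPreadditive C]

/-- A pair `(X, f)` with `X ∈ Φ` and `f ∈ E_X`. -/
structure Rep (Φ : ObjectProperty C) where
  obj : C
  mem : Φ obj
  f : balancedEnd obj

variable {Φ : ObjectProperty C} [Φ.TensorLE Φ Φ]

variable (Φ) in
/-- The generating relations `(X, f) ∼ (a ⊗ X, a ⊗ f)` and `(X, f) ∼ (X ⊗ a, f ⊗ a)`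
for `a ∈ Φ`. -/
inductive Rel : Rep Φ → Rep Φ → Prop
  | left (a X : C) (ha : Φ a) (hX : Φ X) (f : balancedEnd X) :
      Rel ⟨X, hX, f⟩ ⟨a ⊗ X, ObjectProperty.prop_tensor ha hX, tensorOnLeft a f⟩
  | right (X a : C) (hX : Φ X) (ha : Φ a) (f : balancedEnd X) :
      Rel ⟨X, hX, f⟩ ⟨X ⊗ a, ObjectProperty.prop_tensor hX ha, tensorOnRight f a⟩

variable (Φ) in
/-- The set `R_Φ`: the quotient of the set of pairs `(X, f)`, `X ∈ Φ`, `f ∈ E_X`, by the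
smallest equivalence relation containing `Rel Φ`. -/
def RPhi : Type (max u v) := Quot (Rel Φ)

/-- The class `[f_X]` in `R_Φ`. -/
def cls {X : C} (hX : Φ X) (f : balancedEnd X) : RPhi Φ := Quot.mk _ ⟨X, hX, f⟩

lemma cls_left {a X : C} (ha : Φ a) (hX : Φ X) (f : balancedEnd X) :
    cls (ObjectProperty.prop_tensor ha hX : Φ (a ⊗ X)) (tensorOnLeft a f) = cls hX f :=
  (Quot.sound (Rel.left a X ha hX f)).symm

lemma cls_right {X a : C} (hX : Φ X) (ha : Φ a) (f : balancedEnd X) :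
    cls (ObjectProperty.prop_tensor hX ha : Φ (X ⊗ a)) (tensorOnRight f a) = cls hX f :=
  (Quot.sound (Rel.right X a hX ha f)).symm

/-- Endomorphisms which correspond under an isomorphism of objects of `Φ` have the same class. -/
lemma cls_eq_of_iso {X Y : C} (hX : Φ X) (hY : Φ Y) (f : balancedEnd X) (g : balancedEnd Y)
    (e : X ≅ Y) (h : toHom f ≫ e.hom = e.hom ≫ toHom g) : cls hX f = cls hY g := by
  rw [← cls_right hX hY f, ← cls_left hX hY g]
  congr 1
  apply Subtype.ext
  have hf : toHom f ▷ X = X ◁ toHom f := f.2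
  show toHom f ▷ Y = X ◁ toHom g
  rw [← cancel_epi (X ◁ e.hom), ← MonoidalCategory.whiskerLeft_comp, ← h,
    MonoidalCategory.whiskerLeft_comp, ← hf, whisker_exchange]

/-- A binary operation on all the `E_X` which is compatible with the tensor product and
with isomorphisms. -/
structure NatOp (C : Type u) [Category.{v} C] [MonoidalCategory C] [SymmetricCategory C]
    [Preadditive C] [MonoidalPreadditive C] where
  op : ∀ {X : C}, balancedEnd X → balancedEnd X → balancedEnd X
  left : ∀ (a : C) {X : C} (f g : balancedEnd X),
    op (tensorOnLeft a f) (tensorOnLeft a g) = tensorOnLeft a (op f g)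
  right : ∀ (a : C) {X : C} (f g : balancedEnd X),
    op (tensorOnRight f a) (tensorOnRight g a) = tensorOnRight (op f g) a
  iso : ∀ {X Y : C} (e : X ≅ Y) (f g : balancedEnd X) (f' g' : balancedEnd Y),
    toHom f ≫ e.hom = e.hom ≫ toHom f' → toHom g ≫ e.hom = e.hom ≫ toHom g' →
    toHom (op f g) ≫ e.hom = e.hom ≫ toHom (op f' g')

/-- Addition in the rings `E_X`. -/
def NatOp.add : NatOp C where
  op f g := f + g
  left a X f g := Subtype.ext (MonoidalPreadditive.whiskerLeft_add _ _).symm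
  right a X f g := Subtype.ext (MonoidalPreadditive.add_whiskerRight _ _).symm
  iso e f g f' g' h h' := by
    show (toHom f + toHom g) ≫ e.hom = e.hom ≫ (toHom f' + toHom g')
    rw [Preadditive.add_comp, Preadditive.comp_add, h, h']

/-- Multiplication, that is, composition, in the rings `E_X`. -/
def NatOp.mul : NatOp C where
  op f g := f * g
  left a X f g := Subtype.ext (MonoidalCategory.whiskerLeft_comp _ _ _).symm
  right a X f g := Subtype.ext (comp_whiskerRight _ _ _).symm
  iso e f g f' g' h h' := by
    show (toHom g ≫ toHom f) ≫ e.hom = e.hom ≫ (toHom g' ≫ toHom f')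
    rw [Category.assoc, h, reassoc_of% h']

/-- The operation `([f_X], [g_Y]) ↦ [op (f ⊗ Y) (X ⊗ g)]` on `R_Φ`. -/
def NatOp.lift (o : NatOp C) : RPhi Φ → RPhi Φ → RPhi Φ :=
  Quot.lift₂
    (fun x y => cls (ObjectProperty.prop_tensor x.mem y.mem : Φ (x.obj ⊗ y.obj))
      (o.op (tensorOnRight x.f y.obj) (tensorOnLeft x.obj y.f)))
    (by
      rintro ⟨X, hX, f⟩ _ _ (⟨a, Y, ha, hY, g⟩ | ⟨Y, a, hY, ha, g⟩)
      · rw [← cls_left ha]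
        refine cls_eq_of_iso _ _ _ _ ((α_ a X Y).symm ≪≫ whiskerRightIso (β_ a X) Y ≪≫ α_ X a Y) ?_
        rw [← o.left]
        apply o.iso
        · show a ◁ (toHom f ▷ Y) ≫ _ = _ ≫ toHom f ▷ (a ⊗ Y)
          simp only [Iso.trans_hom, Iso.symm_hom, whiskerRightIso_hom, Category.assoc]
          rw [associator_inv_naturality_middle_assoc, ← comp_whiskerRight_assoc,
            BraidedCategory.braiding_naturality_right, comp_whiskerRight_assoc,
            associator_naturality_left]
        · show a ◁ (X ◁ toHom g) ≫ _ = _ ≫ X ◁ (a ◁ toHom g)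
          simp only [Iso.trans_hom, Iso.symm_hom, whiskerRightIso_hom, Category.assoc]
          rw [associator_inv_naturality_right_assoc, whisker_exchange_assoc,
            associator_naturality_right]
      · rw [← cls_right _ ha]
        refine cls_eq_of_iso _ _ _ _ (α_ X Y a) ?_
        rw [← o.right]
        apply o.iso
        · show (toHom f ▷ Y) ▷ a ≫ _ = _ ≫ toHom f ▷ (Y ⊗ a)
          simp
        · show (X ◁ toHom g) ▷ a ≫ _ = _ ≫ X ◁ (toHom g ▷ a)
          simp)
    (by
      rintro _ _ ⟨Y, hY, g⟩ (⟨a, X, ha, hX, f⟩ | ⟨X, a, hX, ha, f⟩)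
      · rw [← cls_left ha]
        refine cls_eq_of_iso _ _ _ _ (α_ a X Y).symm ?_
        rw [← o.left]
        apply o.iso
        · show a ◁ (toHom f ▷ Y) ≫ _ = _ ≫ (a ◁ toHom f) ▷ Y
          simp
        · show a ◁ (X ◁ toHom g) ≫ _ = _ ≫ (a ⊗ X) ◁ toHom g
          simp
      · rw [← cls_right _ ha]
        refine cls_eq_of_iso _ _ _ _ (α_ X Y a ≪≫ whiskerLeftIso X (β_ Y a) ≪≫ (α_ X a Y).symm) ?_
        rw [← o.right]
        apply o.iso
        · show (toHom f ▷ Y) ▷ a ≫ _ = _ ≫ (toHom f ▷ a) ▷ Y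
          simp only [Iso.trans_hom, Iso.symm_hom, whiskerLeftIso_hom, Category.assoc]
          rw [associator_naturality_left_assoc, ← whisker_exchange_assoc,
            associator_inv_naturality_left]
        · show (X ◁ toHom g) ▷ a ≫ _ = _ ≫ (X ⊗ a) ◁ toHom g
          simp only [Iso.trans_hom, Iso.symm_hom, whiskerLeftIso_hom, Category.assoc]
          rw [associator_naturality_middle_assoc, ← MonoidalCategory.whiskerLeft_comp_assoc,
            BraidedCategory.braiding_naturality_left, MonoidalCategory.whiskerLeft_comp_assoc,
            associator_inv_naturality_right])

lemma NatOp.lift_cls (o : NatOp C) {X : C} (hX : Φ X) (f g : balancedEnd X) :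
    o.lift (cls hX f) (cls hX g) = cls hX (o.op f g) := by
  have hg : tensorOnLeft X g = tensorOnRight g X :=
    Subtype.ext (show toHom g ▷ X = X ◁ toHom g from g.2).symm
  show cls (ObjectProperty.prop_tensor hX hX : Φ (X ⊗ X))
    (o.op (tensorOnRight f X) (tensorOnLeft X g)) = _
  rw [hg, o.right, cls_right hX hX]

lemma exists_cls₂ (x y : RPhi Φ) :
    ∃ (Z : C) (hZ : Φ Z) (f g : balancedEnd Z), x = cls hZ f ∧ y = cls hZ g := by
  obtain ⟨⟨X, hX, f⟩, rfl⟩ := Quot.exists_rep x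
  obtain ⟨⟨Y, hY, g⟩, rfl⟩ := Quot.exists_rep y
  exact ⟨X ⊗ Y, ObjectProperty.prop_tensor hX hY, tensorOnRight f Y, tensorOnLeft X g,
    (cls_right hX hY f).symm, (cls_left hX hY g).symm⟩

lemma exists_cls₃ (x y z : RPhi Φ) : ∃ (Z : C) (hZ : Φ Z) (f g h : balancedEnd Z),
    x = cls hZ f ∧ y = cls hZ g ∧ z = cls hZ h := by
  obtain ⟨X, hX, f, g, rfl, rfl⟩ := exists_cls₂ x y
  obtain ⟨⟨Y, hY, h⟩, rfl⟩ := Quot.exists_rep z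
  exact ⟨X ⊗ Y, ObjectProperty.prop_tensor hX hY, tensorOnRight f Y, tensorOnRight g Y,
    tensorOnLeft X h, (cls_right hX hY f).symm, (cls_right hX hY g).symm,
    (cls_left hX hY h).symm⟩

/-- `[f_X] + [g_Y] = [f ⊗ Y + X ⊗ g]`. -/
instance : Add (RPhi Φ) := ⟨NatOp.add.lift⟩

/-- `[f_X] * [g_Y] = [(f ⊗ Y) ∘ (X ⊗ g)]`. -/
instance : Mul (RPhi Φ) := ⟨NatOp.mul.lift⟩

instance : Neg (RPhi Φ) :=
  ⟨Quot.lift (fun x => cls x.mem (-x.f)) (by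
    rintro _ _ (⟨a, X, ha, hX, f⟩ | ⟨X, a, hX, ha, f⟩)
    · show cls hX (-f) = cls (ObjectProperty.prop_tensor ha hX : Φ (a ⊗ X)) (-(tensorOnLeft a f))
      rw [← cls_left ha hX]
      congr 1
      exact Subtype.ext ((tensorLeft a).map_neg (f := toHom f))
    · show cls hX (-f) = cls (ObjectProperty.prop_tensor hX ha : Φ (X ⊗ a)) (-(tensorOnRight f a))
      rw [← cls_right hX ha]
      congr 1
      exact Subtype.ext ((tensorRight a).map_neg (f := toHom f)))⟩

lemma cls_add {X : C} (hX : Φ X) (f g : balancedEnd X) :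
    cls hX f + cls hX g = cls hX (f + g) := NatOp.add.lift_cls hX f g

lemma cls_mul {X : C} (hX : Φ X) (f g : balancedEnd X) :
    cls hX f * cls hX g = cls hX (f * g) := NatOp.mul.lift_cls hX f g

lemma cls_neg {X : C} (hX : Φ X) (f : balancedEnd X) : -cls hX f = cls hX (-f) := rfl

lemma cls_zero_eq {X Y : C} (hX : Φ X) (hY : Φ Y) : cls hX 0 = cls hY 0 := by
  rw [← cls_right hX hY, ← cls_left hX hY]
  congr 1
  exact Subtype.ext
    (MonoidalPreadditive.zero_whiskerRight.trans MonoidalPreadditive.whiskerLeft_zero.symm)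

lemma cls_one_eq {X Y : C} (hX : Φ X) (hY : Φ Y) : cls hX 1 = cls hY 1 := by
  rw [← cls_right hX hY, ← cls_left hX hY]
  congr 1
  exact Subtype.ext ((id_whiskerRight X Y).trans (MonoidalCategory.whiskerLeft_id X Y).symm)

lemma mul_comm_aux (x y : RPhi Φ) : x * y = y * x := by
  obtain ⟨X, hX, f, g, rfl, rfl⟩ := exists_cls₂ x y
  rw [cls_mul, cls_mul, ← cls_right hX hX (f * g), ← cls_right hX hX (g * f)]
  congr 1
  apply Subtype.ext
  have hf : toHom f ▷ X = X ◁ toHom f := f.2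
  show (toHom g ≫ toHom f) ▷ X = (toHom f ≫ toHom g) ▷ X
  rw [comp_whiskerRight, comp_whiskerRight, hf, whisker_exchange]

variable [Φ.Nonempty]

noncomputable instance : Zero (RPhi Φ) := ⟨cls Φ.prop_arbitrary 0⟩

noncomputable instance : One (RPhi Φ) := ⟨cls Φ.prop_arbitrary 1⟩

lemma cls_zero {X : C} (hX : Φ X) : cls hX 0 = (0 : RPhi Φ) := cls_zero_eq _ _

lemma cls_one {X : C} (hX : Φ X) : cls hX 1 = (1 : RPhi Φ) := cls_one_eq _ _

noncomputable instance : CommRing (RPhi Φ) where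
  add_assoc x y z := by
    obtain ⟨X, hX, f, g, h, rfl, rfl, rfl⟩ := exists_cls₃ x y z
    simp only [cls_add, add_assoc]
  zero_add x := by
    obtain ⟨X, hX, f, -, rfl, -⟩ := exists_cls₂ x x
    rw [← cls_zero hX, cls_add, zero_add]
  add_zero x := by
    obtain ⟨X, hX, f, -, rfl, -⟩ := exists_cls₂ x x
    rw [← cls_zero hX, cls_add, add_zero]
  add_comm x y := by
    obtain ⟨X, hX, f, g, rfl, rfl⟩ := exists_cls₂ x y
    rw [cls_add, cls_add, add_comm]
  neg_add_cancel x := by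
    obtain ⟨X, hX, f, -, rfl, -⟩ := exists_cls₂ x x
    rw [cls_neg, cls_add, neg_add_cancel, cls_zero]
  mul_assoc x y z := by
    obtain ⟨X, hX, f, g, h, rfl, rfl, rfl⟩ := exists_cls₃ x y z
    simp only [cls_mul, mul_assoc]
  one_mul x := by
    obtain ⟨X, hX, f, -, rfl, -⟩ := exists_cls₂ x x
    rw [← cls_one hX, cls_mul, one_mul]
  mul_one x := by
    obtain ⟨X, hX, f, -, rfl, -⟩ := exists_cls₂ x x
    rw [← cls_one hX, cls_mul, mul_one]
  left_distrib x y z := by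
    obtain ⟨X, hX, f, g, h, rfl, rfl, rfl⟩ := exists_cls₃ x y z
    simp only [cls_mul, cls_add, mul_add]
  right_distrib x y z := by
    obtain ⟨X, hX, f, g, h, rfl, rfl, rfl⟩ := exists_cls₃ x y z
    simp only [cls_mul, cls_add, add_mul]
  zero_mul x := by
    obtain ⟨X, hX, f, -, rfl, -⟩ := exists_cls₂ x x
    rw [← cls_zero hX, cls_mul, zero_mul]
  mul_zero x := by
    obtain ⟨X, hX, f, -, rfl, -⟩ := exists_cls₂ x x
    rw [← cls_zero hX, cls_mul, mul_zero]
  mul_comm := mul_comm_aux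
  nsmul := nsmulRec
  zsmul := zsmulRec

end Ring

/-! ### Tensor triangulated categories and the spectrum -/

/-- The data and axioms making a triangulated category which is also a symmetric monoidal
category into a tensor triangulated category: the tensor product is exact in each variable,
with respect to natural isomorphisms `Σa ⊗ b ≅ Σ(a ⊗ b)` and `a ⊗ Σb ≅ Σ(a ⊗ b)` which are
compatible with the symmetry, the unitors and the associators, and such that the two ways
`Σa ⊗ Σb ≅ Σ²(a ⊗ b)` of moving suspensions out differ by the sign `-1`. (Additivity of the
tensor product in each variable is Mathlib's class `MonoidalPreadditive`.) -/
class TensorTriangulated (C : Type u) [Category.{v} C] [MonoidalCategory C] [SymmetricCategory C]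
    [Preadditive C] [HasZeroObject C] [HasShift C ℤ]
    [∀ n : ℤ, (shiftFunctor C n).Additive] [Pretriangulated C] where
  shiftTensor (a b : C) : a⟦(1 : ℤ)⟧ ⊗ b ≅ (a ⊗ b)⟦(1 : ℤ)⟧
  tensorShift (a b : C) : a ⊗ b⟦(1 : ℤ)⟧ ≅ (a ⊗ b)⟦(1 : ℤ)⟧
  shiftTensor_natural {a a' b b' : C} (f : a ⟶ a') (g : b ⟶ b') :
    (f⟦(1 : ℤ)⟧' ⊗ₘ g) ≫ (shiftTensor a' b').hom = (shiftTensor a b).hom ≫ (f ⊗ₘ g)⟦(1 : ℤ)⟧'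
  tensorShift_natural {a a' b b' : C} (f : a ⟶ a') (g : b ⟶ b') :
    (f ⊗ₘ g⟦(1 : ℤ)⟧') ≫ (tensorShift a' b').hom = (tensorShift a b).hom ≫ (f ⊗ₘ g)⟦(1 : ℤ)⟧'
  tensorLeft_distinguished (a : C) (T : Triangle C) (hT : T ∈ distTriang C) :
    Triangle.mk (a ◁ T.mor₁) (a ◁ T.mor₂) (a ◁ T.mor₃ ≫ (tensorShift a T.obj₁).hom) ∈ distTriang C
  tensorRight_distinguished (a : C) (T : Triangle C) (hT : T ∈ distTriang C) :
    Triangle.mk (T.mor₁ ▷ a) (T.mor₂ ▷ a) (T.mor₃ ▷ a ≫ (shiftTensor T.obj₁ a).hom) ∈ distTriang C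
  shiftTensor_braiding (a b : C) :
    (shiftTensor a b).hom ≫ (β_ a b).hom⟦(1 : ℤ)⟧' =
      (β_ (a⟦(1 : ℤ)⟧) b).hom ≫ (tensorShift b a).hom
  shiftTensor_rightUnitor (a : C) :
    (shiftTensor a (𝟙_ C)).hom ≫ (ρ_ a).hom⟦(1 : ℤ)⟧' = (ρ_ (a⟦(1 : ℤ)⟧)).hom
  shiftTensor_associator (a b c : C) :
    (shiftTensor a b).hom ▷ c ≫ (shiftTensor (a ⊗ b) c).hom ≫ (α_ a b c).hom⟦(1 : ℤ)⟧' =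
      (α_ (a⟦(1 : ℤ)⟧) b c).hom ≫ (shiftTensor a (b ⊗ c)).hom
  anticommute (a b : C) :
    (shiftTensor a (b⟦(1 : ℤ)⟧)).hom ≫ (tensorShift a b).hom⟦(1 : ℤ)⟧' =
      -((tensorShift (a⟦(1 : ℤ)⟧) b).hom ≫ (shiftTensor a b).hom⟦(1 : ℤ)⟧')

section Spectrum

variable {C : Type u} [Category.{v} C] [MonoidalCategory C]
  [Preadditive C] [HasZeroObject C] [HasShift C ℤ]
  [∀ n : ℤ, (shiftFunctor C n).Additive] [Pretriangulated C]

variable (C) in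
/-- The set `Spc(C)` of prime `⊗`-ideals: proper thick (that is, triangulated and closed under
direct summands) `⊗`-ideals `P` such that `a ⊗ b ∈ P` implies `a ∈ P` or `b ∈ P`. -/
structure Spc where
  mem : ObjectProperty C
  isTriangulated : mem.IsTriangulated
  isStableUnderRetracts : mem.IsStableUnderRetracts
  tensor_mem (a : C) {b : C} : mem b → mem (a ⊗ b)
  exists_not_mem : ∃ a, ¬ mem a
  mem_or_mem {a b : C} : mem (a ⊗ b) → mem a ∨ mem b

attribute [instance] Spc.isTriangulated Spc.isStableUnderRetracts

/-- The support of an object. -/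
def supp (X : C) : Set (Spc C) := {P | ¬ P.mem X}

/-- The set `Z_Φ`, the intersection of the supports of the objects of `Φ`. -/
def suppPhi (Φ : ObjectProperty C) : Set (Spc C) := {P | ∀ X, Φ X → P ∈ supp X}

/-- The cone of `f` belongs to `P`. -/
def ConeMem (P : Spc C) {X Y : C} (f : X ⟶ Y) : Prop :=
  ∃ (Z : C) (g : Y ⟶ Z) (h : Z ⟶ X⟦(1 : ℤ)⟧), Triangle.mk f g h ∈ distTriang C ∧ P.mem Z

lemma tensorLeft_mk [SymmetricCategory C] [TensorTriangulated C] (a : C) {X Y Z : C} {f : X ⟶ Y}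
    {g : Y ⟶ Z} {h : Z ⟶ X⟦(1 : ℤ)⟧} (hT : Triangle.mk f g h ∈ distTriang C) :
    Triangle.mk (a ◁ f) (a ◁ g) (a ◁ h ≫ (TensorTriangulated.tensorShift a X).hom) ∈
      distTriang C :=
  TensorTriangulated.tensorLeft_distinguished a _ hT

lemma tensorRight_mk [SymmetricCategory C] [TensorTriangulated C] (a : C) {X Y Z : C} {f : X ⟶ Y}
    {g : Y ⟶ Z} {h : Z ⟶ X⟦(1 : ℤ)⟧} (hT : Triangle.mk f g h ∈ distTriang C) :
    Triangle.mk (f ▷ a) (g ▷ a) (h ▷ a ≫ (TensorTriangulated.shiftTensor X a).hom) ∈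
      distTriang C :=
  TensorTriangulated.tensorRight_distinguished a _ hT

namespace Spc

variable (P : Spc C)

lemma coneMem_iff_trW {X Y : C} (f : X ⟶ Y) : ConeMem P f ↔ P.mem.trW f := by
  rw [ObjectProperty.trW_iff]
  constructor
  · rintro ⟨Z, g, h, hT, hZ⟩
    exact ⟨Z, g, h, hT, hZ⟩
  · rintro ⟨Z, g, h, hT, hZ⟩
    exact ⟨Z, g, h, hT, hZ⟩

lemma coneMem_iff {X Y Z : C} {f : X ⟶ Y} {g : Y ⟶ Z} {h : Z ⟶ X⟦(1 : ℤ)⟧}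
    (hT : Triangle.mk f g h ∈ distTriang C) : ConeMem P f ↔ P.mem Z := by
  rw [coneMem_iff_trW]
  exact P.mem.trW_iff_of_distinguished _ hT

lemma coneMem_id (X : C) : ConeMem P (𝟙 X) := by
  rw [coneMem_iff_trW]
  exact P.mem.trW_of_isIso _

lemma coneMem_comp [IsTriangulated C] {X Y Z : C} {f : X ⟶ Y} {g : Y ⟶ Z} (hf : ConeMem P f)
    (hg : ConeMem P g) : ConeMem P (f ≫ g) := by
  rw [coneMem_iff_trW] at *
  exact P.mem.trW.comp_mem _ _ hf hg

lemma mem_of_coneMem_zero {T : C} (h : ConeMem P (0 : T ⟶ T)) : P.mem T := by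
  obtain ⟨Z, g, k, hT, hZ⟩ := h
  obtain ⟨r, hr⟩ := Triangle.yoneda_exact₂ _ hT (𝟙 T) zero_comp
  exact P.mem.prop_of_retract ⟨g, r, hr.symm⟩ hZ

variable [SymmetricCategory C]

lemma mem_tensor_right {a : C} (b : C) (h : P.mem a) : P.mem (a ⊗ b) :=
  P.mem.prop_of_iso (β_ b a) (P.tensor_mem b h)

variable [TensorTriangulated C]

lemma coneMem_whiskerLeft_iff {a X Y : C} (ha : ¬ P.mem a) (f : X ⟶ Y) :
    ConeMem P (a ◁ f) ↔ ConeMem P f := by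
  obtain ⟨Z, g, h, hT⟩ := distinguished_cocone_triangle f
  rw [P.coneMem_iff hT, P.coneMem_iff (tensorLeft_mk a hT)]
  exact ⟨fun h => (P.mem_or_mem h).resolve_left ha, P.tensor_mem a⟩

lemma coneMem_whiskerRight {X Y : C} {f : X ⟶ Y} (hf : ConeMem P f) (a : C) :
    ConeMem P (f ▷ a) := by
  obtain ⟨Z, g, h, hT⟩ := distinguished_cocone_triangle f
  rw [P.coneMem_iff hT] at hf
  rw [P.coneMem_iff (tensorRight_mk a hT)]
  exact P.mem_tensor_right a hf

lemma coneMem_whiskerRight_iff {a X Y : C} (ha : ¬ P.mem a) (f : X ⟶ Y) :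
    ConeMem P (f ▷ a) ↔ ConeMem P f := by
  obtain ⟨Z, g, h, hT⟩ := distinguished_cocone_triangle f
  rw [P.coneMem_iff hT, P.coneMem_iff (tensorRight_mk a hT)]
  exact ⟨fun h => (P.mem_or_mem h).resolve_right ha, P.mem_tensor_right a⟩

end Spc

variable [SymmetricCategory C] [TensorTriangulated C]

lemma IsBalanced.whiskerRight_cone_sq {X Z : C} {f : X ⟶ X} (hf : IsBalanced f) {g : X ⟶ Z}
    {h : Z ⟶ X⟦(1 : ℤ)⟧} (hT : Triangle.mk f g h ∈ distTriang C) :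
    f ▷ Z ≫ f ▷ Z = 0 := by
  have hf' : f ▷ X = X ◁ f := hf
  have hXT := tensorLeft_mk X hT
  have h12 : X ◁ f ≫ X ◁ g = 0 := comp_distTriang_mor_zero₁₂ _ hXT
  have h31 : (X ◁ h ≫ (TensorTriangulated.tensorShift X X).hom) ≫ (X ◁ f)⟦(1 : ℤ)⟧' = 0 :=
    comp_distTriang_mor_zero₃₁ _ hXT
  have hs : ∃ s : (X ⊗ X)⟦(1 : ℤ)⟧ ⟶ X ⊗ Z,
      f ▷ Z = (X ◁ h ≫ (TensorTriangulated.tensorShift X X).hom) ≫ s :=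
    Triangle.yoneda_exact₃ _ hXT (f ▷ Z)
      (show X ◁ g ≫ f ▷ Z = 0 by rw [whisker_exchange, hf', h12])
  obtain ⟨s, hs⟩ := hs
  have hn := TensorTriangulated.tensorShift_natural f (𝟙 X)
  simp only [CategoryTheory.Functor.map_id, tensorHom_id] at hn
  have hz : f ▷ Z ≫ X ◁ h ≫ (TensorTriangulated.tensorShift X X).hom = 0 := by
    rw [← whisker_exchange_assoc, hn, hf', ← Category.assoc, h31]
  calc f ▷ Z ≫ f ▷ Z = f ▷ Z ≫ ((X ◁ h ≫ (TensorTriangulated.tensorShift X X).hom) ≫ s) :=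
        congrArg (fun t => f ▷ Z ≫ t) hs
    _ = (f ▷ Z ≫ X ◁ h ≫ (TensorTriangulated.tensorShift X X).hom) ≫ s :=
        (Category.assoc _ _ _).symm
    _ = 0 := by rw [hz, zero_comp]

variable [MonoidalPreadditive C] [IsTriangulated C]

lemma not_coneMem_comp (P : Spc C) {X : C} (hX : ¬ P.mem X) {f : X ⟶ X} (hf : IsBalanced f)
    (r : X ⟶ X) (hc : ¬ ConeMem P f) : ¬ ConeMem P (f ≫ r) := by
  obtain ⟨A, g, h, hT⟩ := distinguished_cocone_triangle f
  rw [P.coneMem_iff hT] at hc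
  intro hu
  have hu' := P.coneMem_whiskerRight hu (X ⊗ A)
  have key : (f ≫ r) ▷ (X ⊗ A) ≫ (f ≫ r) ▷ (X ⊗ A) = 0 := by
    rw [comp_whiskerRight, hf.whiskerRight_eq, Category.assoc, ← whisker_exchange_assoc,
      ← MonoidalCategory.whiskerLeft_comp_assoc, hf.whiskerRight_cone_sq hT]
    simp
  have hm := P.mem_of_coneMem_zero (key ▸ P.coneMem_comp hu' hu')
  rcases P.mem_or_mem hm with h1 | h1
  · exact hX h1
  · exact (P.mem_or_mem h1).elim hX hc

lemma not_coneMem_add (P : Spc C) {X : C} (hX : ¬ P.mem X) {f g : X ⟶ X} (hf : IsBalanced f)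
    (hg : IsBalanced g) (hcf : ¬ ConeMem P f) (hcg : ¬ ConeMem P g) : ¬ ConeMem P (f + g) := by
  obtain ⟨A, f₂, f₃, hfT⟩ := distinguished_cocone_triangle f
  obtain ⟨B, g₂, g₃, hgT⟩ := distinguished_cocone_triangle g
  rw [P.coneMem_iff hfT] at hcf
  rw [P.coneMem_iff hgT] at hcg
  intro hu
  have hu' := P.coneMem_whiskerRight hu (X ⊗ (A ⊗ B))
  have hf2 := whiskerRight_sq_tensor (hf.whiskerRight_cone_sq hfT) B
  have hg2 : g ▷ (A ⊗ B) ≫ g ▷ (A ⊗ B) = 0 := by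
    have h1 := whiskerRight_sq_tensor (hg.whiskerRight_cone_sq hgT) A
    rw [← cancel_mono (X ◁ (β_ A B).hom), zero_comp, Category.assoc, ← whisker_exchange,
      ← whisker_exchange_assoc, h1, comp_zero]
  let p : End (X ⊗ (X ⊗ (A ⊗ B))) := f ▷ (X ⊗ (A ⊗ B))
  let q : End (X ⊗ (X ⊗ (A ⊗ B))) := g ▷ (X ⊗ (A ⊗ B))
  have hp : p * p = 0 := by
    show f ▷ (X ⊗ (A ⊗ B)) ≫ f ▷ (X ⊗ (A ⊗ B)) = 0
    rw [hf.whiskerRight_eq, ← MonoidalCategory.whiskerLeft_comp, hf2]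
    simp
  have hq : q * q = 0 := by
    show g ▷ (X ⊗ (A ⊗ B)) ≫ g ▷ (X ⊗ (A ⊗ B)) = 0
    rw [hg.whiskerRight_eq, ← MonoidalCategory.whiskerLeft_comp, hg2]
    simp
  have hpq : q * p = p * q := by
    show f ▷ (X ⊗ (A ⊗ B)) ≫ g ▷ (X ⊗ (A ⊗ B)) = g ▷ (X ⊗ (A ⊗ B)) ≫ f ▷ (X ⊗ (A ⊗ B))
    rw [hf.whiskerRight_eq, whisker_exchange]
  have hcube : (p + q) * ((p + q) * (p + q)) = 0 := by
    have : (p + q) * ((p + q) * (p + q)) = (p * p) * p + (p * p) * q + p * (q * p) + p * (q * q)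
        + (q * p) * p + (q * p) * q + (q * q) * p + (q * q) * q := by noncomm_ring
    rw [this, hpq, mul_assoc p q p, hpq, mul_assoc p q q, ← mul_assoc p p q, hp, hq]
    simp
  have hsum : (f + g) ▷ (X ⊗ (A ⊗ B)) = p + q := MonoidalPreadditive.add_whiskerRight _ _
  have hm : ConeMem P (0 : X ⊗ (X ⊗ (A ⊗ B)) ⟶ X ⊗ (X ⊗ (A ⊗ B))) := by
    rw [hsum] at hu'
    have := P.coneMem_comp (P.coneMem_comp hu' hu') hu'
    exact hcube ▸ this
  rcases P.mem_or_mem (P.mem_of_coneMem_zero hm) with h1 | h1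
  · exact hX h1
  rcases P.mem_or_mem h1 with h1 | h1
  · exact hX h1
  · exact (P.mem_or_mem h1).elim hcf hcg

/-- For `P ∈ Z_Φ`, the condition `cone(f) ∈ P` only depends on the class of `f` in `R_Φ`. -/
def RPhi.ConeMem {Φ : ObjectProperty C} [Φ.TensorLE Φ Φ] (P : suppPhi Φ) : RPhi Φ → Prop :=
  Quot.lift (fun x => TTGeometry.ConeMem P.1 (toHom x.f)) (by
    rintro _ _ (⟨a, X, ha, hX, f⟩ | ⟨X, a, hX, ha, f⟩)
    · exact propext (P.1.coneMem_whiskerLeft_iff (P.2 a ha) (toHom f)).symm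
    · exact propext (P.1.coneMem_whiskerRight_iff (P.2 a ha) (toHom f)).symm)

/-- The comparison map `ρ_Φ : Z_Φ → Spec(R_Φ)`, `P ↦ {[f] ∣ cone(f) ∉ P}`. -/
def rhoPhi (Φ : ObjectProperty C) [Φ.TensorLE Φ Φ] [Φ.Nonempty] (P : suppPhi Φ) :
    PrimeSpectrum (RPhi Φ) where
  asIdeal :=
    { carrier := {x | ¬ RPhi.ConeMem P x}
      add_mem' := by
        intro x y hx hy
        obtain ⟨X, hX, f, g, rfl, rfl⟩ := exists_cls₂ x y
        rw [cls_add]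
        exact not_coneMem_add P.1 (P.2 X hX) f.2 g.2 hx hy
      zero_mem' := fun h => P.2 _ Φ.prop_arbitrary (P.1.mem_of_coneMem_zero h)
      smul_mem' := by
        intro x y hy
        obtain ⟨X, hX, f, g, rfl, rfl⟩ := exists_cls₂ x y
        rw [smul_eq_mul, cls_mul]
        exact not_coneMem_comp P.1 (P.2 X hX) g.2 (toHom f) hy }
  isPrime := by
    constructor
    · rw [Ideal.ne_top_iff_one]
      exact fun h => h (P.1.coneMem_id _)
    · intro x y hxy
      obtain ⟨X, hX, f, g, rfl, rfl⟩ := exists_cls₂ x y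
      by_contra hcon
      rw [not_or] at hcon
      refine hxy ?_
      rw [cls_mul]
      exact P.1.coneMem_comp (not_not.1 hcon.2) (not_not.1 hcon.1)

end Spectrum

/-! ### Object comparison maps -/

section Object

variable {C : Type u} [Category.{v} C] [MonoidalCategory C]

/-- The tensor power `X^{⊗ n}`. -/
def tensorPow (X : C) : ℕ → C
  | 0 => 𝟙_ C
  | 1 => X
  | n + 2 => X ⊗ tensorPow X (n + 1)

/-- The family `{X^{⊗ n} ∣ n ≥ 1}`, closed up under isomorphism, which makes it closed under the
(not strictly associative) tensor product; isomorphic pairs `(Z, f)` have the same class in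
`R_Φ` in any case, see `cls_eq_of_iso`. -/
def tensorPowers (X : C) : ObjectProperty C :=
  fun Z => ∃ n : ℕ, 1 ≤ n ∧ Nonempty (Z ≅ tensorPow X n)

lemma tensorPow_mem (X : C) {n : ℕ} (hn : 1 ≤ n) : tensorPowers X (tensorPow X n) :=
  ⟨n, hn, ⟨Iso.refl _⟩⟩

instance (X : C) : (tensorPowers X).Nonempty := ⟨⟨_, tensorPow_mem X le_rfl⟩⟩

/-- `X^{⊗ (n + 1)} ≅ X ⊗ X^{⊗ n}`. -/
def tensorPowSucc (X : C) : ∀ n : ℕ, tensorPow X (n + 1) ≅ X ⊗ tensorPow X n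
  | 0 => (ρ_ X).symm
  | _ + 1 => Iso.refl _

/-- `X^{⊗ m} ⊗ X^{⊗ n} ≅ X^{⊗ (m + n)}`. -/
def tensorPowAdd (X : C) : ∀ m n : ℕ, tensorPow X m ⊗ tensorPow X n ≅ tensorPow X (m + n)
  | 0, n => λ_ _ ≪≫ eqToIso (by rw [Nat.zero_add])
  | m + 1, n => whiskerRightIso (tensorPowSucc X m) _ ≪≫ α_ _ _ _ ≪≫
      whiskerLeftIso X (tensorPowAdd X m n) ≪≫ (tensorPowSucc X (m + n)).symm ≪≫
      eqToIso (by rw [Nat.succ_add])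

instance (X : C) : (tensorPowers X).TensorLE (tensorPowers X) (tensorPowers X) where
  prop_tensor := by
    rintro Z W ⟨m, hm, ⟨e⟩⟩ ⟨n, hn, ⟨e'⟩⟩
    exact ⟨m + n, by omega, ⟨(e ⊗ᵢ e') ≪≫ tensorPowAdd X m n⟩⟩

/-- `X^{⊗ n} ≅ Y^{⊗ n}` if `X ≅ Y`. -/
def tensorPowIso {X Y : C} (e : X ≅ Y) : ∀ n : ℕ, tensorPow X n ≅ tensorPow Y n
  | 0 => Iso.refl _
  | n + 1 => tensorPowSucc X n ≪≫ (e ⊗ᵢ tensorPowIso e n) ≪≫ (tensorPowSucc Y n).symm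

lemma Spc.not_mem_tensorPow [Preadditive C] [HasZeroObject C] [HasShift C ℤ]
    [∀ n : ℤ, (shiftFunctor C n).Additive] [Pretriangulated C] (P : Spc C) {X : C} (hX : ¬ P.mem X) :
    ∀ n : ℕ, ¬ P.mem (tensorPow X (n + 1))
  | 0 => hX
  | n + 1 => fun h => (P.mem_or_mem h).elim hX (P.not_mem_tensorPow hX n)

variable [SymmetricCategory C]

/-- The isomorphism `X^{⊗ n} ⊗ Y^{⊗ n} ≅ (X ⊗ Y)^{⊗ n}` given by the symmetry which preserves
the order of the `X`'s and the order of the `Y`'s. -/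
def tensorPowTensor (X Y : C) :
    ∀ n : ℕ, tensorPow X n ⊗ tensorPow Y n ≅ tensorPow (X ⊗ Y) n
  | 0 => λ_ _
  | n + 1 => (tensorPowSucc X n ⊗ᵢ tensorPowSucc Y n) ≪≫
      ⟨tensorμ _ _ _ _, tensorδ _ _ _ _, tensorμ_tensorδ _ _ _ _, tensorδ_tensorμ _ _ _ _⟩ ≪≫
      whiskerLeftIso (X ⊗ Y) (tensorPowTensor X Y n) ≪≫ (tensorPowSucc (X ⊗ Y) n).symm

/-- `(X^{⊗ (k-1)})^{⊗ n} ⊗ (X ⊗ Y)^{⊗ n}` is isomorphic to `(X^{⊗ k} ⊗ Y)^{⊗ n}`. -/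
lemma tensorPow_tensor_mem (X Y : C) {k n : ℕ} (hk : 1 ≤ k) (hn : 1 ≤ n) :
    tensorPowers (tensorPow X k ⊗ Y)
      (tensorPow (tensorPow X (k - 1)) n ⊗ tensorPow (X ⊗ Y) n) := by
  obtain ⟨k, rfl⟩ := Nat.exists_eq_add_of_le' hk
  exact ⟨n, hn, ⟨tensorPowTensor _ _ n ≪≫ tensorPowIso ((α_ _ _ _).symm ≪≫
    whiskerRightIso (tensorPowAdd X k 1) Y) n⟩⟩

variable [Preadditive C] [MonoidalPreadditive C]

/-- The ring `R_X`, that is, `R_Φ` for the family `Φ` of the powers `X^{⊗ n}`, `n ≥ 1`. -/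
abbrev RObj (X : C) : Type (max u v) := RPhi (tensorPowers X)

variable [HasZeroObject C] [HasShift C ℤ] [∀ n : ℤ, (shiftFunctor C n).Additive]
  [Pretriangulated C]

lemma supp_le_suppPhi (X : C) : supp X ≤ suppPhi (tensorPowers X) := by
  rintro P hP Z ⟨n, hn, ⟨e⟩⟩ hZ
  obtain ⟨n, rfl⟩ := Nat.exists_eq_add_of_le' hn
  exact P.not_mem_tensorPow hP n (P.mem.prop_of_iso e hZ)

/-- The object comparison map `ρ_X : supp(X) → Spec(R_X)`. -/
def rho [TensorTriangulated C] [IsTriangulated C] (X : C) (P : supp X) :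
    PrimeSpectrum (RObj X) :=
  rhoPhi (tensorPowers X) ⟨P.1, supp_le_suppPhi X P.2⟩

end Object

end TTGeometry

/-! Tensoring with `W` and with `W'` gives the same class because `f` is balanced. If `f ∈ E_Z`,
then for every object `c` the symmetry turns `f ⊗ Z = Z ⊗ f` into `f ⊗ (c ⊗ Z) = Z ⊗ (c ⊗ f)`
(`IsBalanced.whiskerRight_tensor`). Taking `c = W'` and tensoring with `W`, one finds that `(W ⊗ f)
⊗ (W' ⊗ Z)` and `(W ⊗ Z) ⊗ (W' ⊗ f)` agree up to associators. Hence `[W ⊗ f] = [W' ⊗ f]` in `R_Ψ`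
once `W ⊗ Z` and `W' ⊗ Z` lie in `Ψ`; neither `W`, `W'` nor `Z` has to lie in `Ψ`.

So if every object of `Φ` has a tensor multiple in `Ψ`, there is a canonical map `R_Φ → R_Ψ`, `[f] ↦
[W ⊗ f]` (`RPhi.transfer`). If the converse holds too, the two maps are mutually inverse, since
going there and back replaces `f` by `(V ⊗ W) ⊗ f`. The comparison maps correspond because `cone(W ⊗
f) = W ⊗ cone(f)`, and a prime `P` avoiding `W ⊗ Z` also avoids `W`.

For the proposition it remains to find multiples: `X^{k-1} ⊗ (X ⊗ Y) ≅ X^k ⊗ Y` in one direction and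
`Y^{k-1} ⊗ (X^k ⊗ Y) ≅ (X ⊗ Y)^k` in the other, then powers of these. -/

namespace TTGeometry

/-! ### Transfer between the rings of two families with common tensor multiples -/

section TransferRing

variable {C : Type u} [Category.{v} C] [MonoidalCategory C] [SymmetricCategory C]
  [Preadditive C] [MonoidalPreadditive C]

lemma toHom_tensorOnLeft (W : C) {Z : C} (f : balancedEnd Z) :
    toHom (tensorOnLeft W f) = W ◁ toHom f := rfl

/-- The class of `W ⊗ f` in `R_Φ` does not depend on the object `W` with `W ⊗ Z ∈ Φ`. -/
lemma cls_tensorOnLeft_eq {Φ : ObjectProperty C} [Φ.TensorLE Φ Φ] {Z W W' : C}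
    (h : Φ (W ⊗ Z)) (h' : Φ (W' ⊗ Z)) (f : balancedEnd Z) :
    cls h (tensorOnLeft W f) = cls h' (tensorOnLeft W' f) := by
  rw [← cls_right h h' (tensorOnLeft W f), ← cls_left h h' (tensorOnLeft W' f)]
  congr 1
  apply Subtype.ext
  have hf : toHom f ▷ (W' ⊗ Z) = Z ◁ (W' ◁ toHom f) := f.2.whiskerRight_tensor W'
  show (W ◁ toHom f) ▷ (W' ⊗ Z) = (W ⊗ Z) ◁ (W' ◁ toHom f)
  rw [whisker_assoc, hf, tensor_whiskerLeft]

/-- `[W ⊗ f] = [f]` as soon as both classes are defined. -/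
lemma cls_tensorOnLeft {Φ : ObjectProperty C} [Φ.TensorLE Φ Φ] {Z W : C}
    (hZ : Φ Z) (h : Φ (W ⊗ Z)) (f : balancedEnd Z) :
    cls h (tensorOnLeft W f) = cls hZ f := by
  -- The object `W` is traded for `Z` itself, which does lie in `Φ`, so that a generating relation
  -- applies.
  rw [cls_tensorOnLeft_eq h (ObjectProperty.prop_tensor hZ hZ), cls_left hZ]

/-- Needed for `RPhi.transfer` to respect the left generating relation, where `V` and `W` are
unrelated choices. The two classes are compared on `(V ⊗ a ⊗ X) ⊗ (W ⊗ X)`, so no reassociated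
object has to belong to `Ψ`. -/
lemma cls_tensorOnLeft_tensorOnLeft {Ψ : ObjectProperty C} [Ψ.TensorLE Ψ Ψ] {a X V W : C}
    (hV : Ψ (V ⊗ a ⊗ X)) (hW : Ψ (W ⊗ X)) (f : balancedEnd X) :
    cls hV (tensorOnLeft V (tensorOnLeft a f)) = cls hW (tensorOnLeft W f) := by
  rw [← cls_left hV hW, ← cls_right hV hW]
  congr 1
  apply Subtype.ext
  have h1 : toHom f ▷ (W ⊗ X) = X ◁ (W ◁ toHom f) := f.2.whiskerRight_tensor W
  show (V ◁ a ◁ toHom f) ▷ (W ⊗ X) = (V ⊗ a ⊗ X) ◁ (W ◁ toHom f)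
  rw [whisker_assoc, whisker_assoc, h1, tensor_whiskerLeft, tensor_whiskerLeft]

/-- The counterpart for the right generating relation. -/
lemma cls_tensorOnLeft_tensorOnRight {Ψ : ObjectProperty C} [Ψ.TensorLE Ψ Ψ] {a X V W : C}
    (hV : Ψ (V ⊗ X ⊗ a)) (hW : Ψ (W ⊗ X)) (f : balancedEnd X) :
    cls hV (tensorOnLeft V (tensorOnRight f a)) = cls hW (tensorOnLeft W f) := by
  rw [← cls_left hV hW, ← cls_right hV hW]
  congr 1
  apply Subtype.ext
  -- Here `a` stands between the two copies of `X`, together with `W`, so balancedness is used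
  -- across `a ⊗ W`.
  have h1 : toHom f ▷ ((a ⊗ W) ⊗ X) = X ◁ ((a ⊗ W) ◁ toHom f) :=
    f.2.whiskerRight_tensor (a ⊗ W)
  show (V ◁ (toHom f ▷ a)) ▷ (W ⊗ X) = (V ⊗ X ⊗ a) ◁ (W ◁ toHom f)
  calc (V ◁ (toHom f ▷ a)) ▷ (W ⊗ X)
      = 𝟙 _ ⊗≫ V ◁ (toHom f ▷ ((a ⊗ W) ⊗ X)) ⊗≫ 𝟙 _ := by monoidal
    _ = 𝟙 _ ⊗≫ V ◁ (X ◁ ((a ⊗ W) ◁ toHom f)) ⊗≫ 𝟙 _ := by rw [h1]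
    _ = (V ⊗ X ⊗ a) ◁ (W ◁ toHom f) := by monoidal

variable {Φ Ψ : ObjectProperty C} [Φ.TensorLE Φ Φ] [Ψ.TensorLE Ψ Ψ]

/-- The map `R_Φ → R_Ψ`, `[f_Z] ↦ [W ⊗ f]`, where `W` is any object such that `W ⊗ Z ∈ Ψ`. -/
noncomputable def RPhi.transfer (h : ∀ Z, Φ Z → ∃ W, Ψ (W ⊗ Z)) : RPhi Φ → RPhi Ψ :=
  Quot.lift (fun x => cls (h x.obj x.mem).choose_spec (tensorOnLeft _ x.f)) (by
    rintro _ _ (⟨a, X, ha, hX, f⟩ | ⟨X, a, hX, ha, f⟩)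
    · exact (cls_tensorOnLeft_tensorOnLeft _ _ f).symm
    · exact (cls_tensorOnLeft_tensorOnRight _ _ f).symm)

/-- Any multiplier `W` computes the transfer, not only the one picked by choice. This is what yields
the explicit formula for `φ`. -/
lemma RPhi.transfer_cls (h : ∀ Z, Φ Z → ∃ W, Ψ (W ⊗ Z)) {Z W : C} (hZ : Φ Z)
    (hW : Ψ (W ⊗ Z)) (f : balancedEnd Z) :
    RPhi.transfer h (cls hZ f) = cls hW (tensorOnLeft W f) :=
  cls_tensorOnLeft_eq _ _ f

lemma RPhi.transfer_transfer (h : ∀ Z, Φ Z → ∃ W, Ψ (W ⊗ Z)) (h' : ∀ Z, Ψ Z → ∃ W, Φ (W ⊗ Z))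
    [Φ.IsClosedUnderIsomorphisms] (x : RPhi Φ) :
    RPhi.transfer h' (RPhi.transfer h x) = x := by
  obtain ⟨Z, hZ, f, -, rfl, -⟩ := exists_cls₂ x x
  obtain ⟨W, hW⟩ := h Z hZ
  obtain ⟨V, hV⟩ := h' _ hW
  -- Nothing places `V ⊗ W` in `Φ`, but `cls_tensorOnLeft` only asks this of its product with `Z`.
  -- Closure under isomorphisms serves to reassociate.
  have hVW : Φ ((V ⊗ W) ⊗ Z) := Φ.prop_of_iso (α_ V W Z).symm hV
  rw [transfer_cls h hZ hW, transfer_cls h' hW hV, ← cls_tensorOnLeft hZ hVW]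
  refine cls_eq_of_iso _ _ _ _ (α_ V W Z).symm ?_
  simp [toHom_tensorOnLeft]

/-- If every object of `Φ` has a multiple in `Ψ` and conversely, then `R_Φ ≃ R_Ψ`. -/
noncomputable def RPhi.transferEquiv [Φ.Nonempty] [Ψ.Nonempty]
    [Φ.IsClosedUnderIsomorphisms] [Ψ.IsClosedUnderIsomorphisms]
    (h : ∀ Z, Φ Z → ∃ W, Ψ (W ⊗ Z)) (h' : ∀ Z, Ψ Z → ∃ W, Φ (W ⊗ Z)) : RPhi Φ ≃+* RPhi Ψ where
  toFun := RPhi.transfer h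
  invFun := RPhi.transfer h'
  left_inv := RPhi.transfer_transfer h h'
  right_inv := RPhi.transfer_transfer h' h
  map_mul' x y := by
    -- With both classes represented on one `Z`, a single `W` serves for both, and `W ⊗ -` commutes
    -- with composition.
    obtain ⟨Z, hZ, f, g, rfl, rfl⟩ := exists_cls₂ x y
    obtain ⟨W, hW⟩ := h Z hZ
    simp only [cls_mul, transfer_cls h hZ hW]
    exact congrArg (cls hW) (NatOp.mul.left W f g).symm
  map_add' x y := by
    obtain ⟨Z, hZ, f, g, rfl, rfl⟩ := exists_cls₂ x y
    obtain ⟨W, hW⟩ := h Z hZ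
    simp only [cls_add, transfer_cls h hZ hW]
    exact congrArg (cls hW) (NatOp.add.left W f g).symm

end TransferRing

/-! ### Compatibility of the transfer with the comparison maps -/

section TransferSpectrum

variable {C : Type u} [Category.{v} C] [MonoidalCategory C] [SymmetricCategory C]
  [Preadditive C] [MonoidalPreadditive C] [HasZeroObject C] [HasShift C ℤ]
  [∀ n : ℤ, (shiftFunctor C n).Additive] [Pretriangulated C] [TensorTriangulated C]

/-- The cone of `W ⊗ f` is `W ⊗ cone(f)`, and by primality the factor `W ∉ P` does not affect
membership in `P`. -/
lemma RPhi.coneMem_transfer {Φ Ψ : ObjectProperty C} [Φ.TensorLE Φ Φ] [Ψ.TensorLE Ψ Ψ]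
    (h : ∀ Z, Φ Z → ∃ W, Ψ (W ⊗ Z)) {P : Spc C} (hΦ : P ∈ suppPhi Φ) (hΨ : P ∈ suppPhi Ψ)
    (x : RPhi Φ) :
    RPhi.ConeMem (⟨P, hΨ⟩ : suppPhi Ψ) (RPhi.transfer h x) ↔
      RPhi.ConeMem (⟨P, hΦ⟩ : suppPhi Φ) x := by
  obtain ⟨⟨Z, hZ, f⟩, rfl⟩ := Quot.exists_rep x
  obtain ⟨W, hW⟩ := h Z hZ
  -- If `W` were in the ideal `P`, so would be `W ⊗ Z`, an object of `Ψ`.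
  have hPW : ¬ P.mem W := fun hP => hΨ _ hW (P.mem_tensor_right Z hP)
  have e : RPhi.transfer h (Quot.mk _ ⟨Z, hZ, f⟩) = cls hW (tensorOnLeft W f) :=
    RPhi.transfer_cls h hZ hW f
  rw [e]
  exact P.coneMem_whiskerLeft_iff hPW (toHom f)

variable [IsTriangulated C] in
lemma comap_transferEquiv_rhoPhi {Φ Ψ : ObjectProperty C} [Φ.TensorLE Φ Φ] [Ψ.TensorLE Ψ Ψ]
    [Φ.Nonempty] [Ψ.Nonempty] [Φ.IsClosedUnderIsomorphisms] [Ψ.IsClosedUnderIsomorphisms]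
    (h : ∀ Z, Φ Z → ∃ W, Ψ (W ⊗ Z)) (h' : ∀ Z, Ψ Z → ∃ W, Φ (W ⊗ Z)) {P : Spc C}
    (hΦ : P ∈ suppPhi Φ) (hΨ : P ∈ suppPhi Ψ) :
    PrimeSpectrum.comap (RPhi.transferEquiv h h' : RPhi Φ →+* RPhi Ψ) (rhoPhi Ψ ⟨P, hΨ⟩) =
      rhoPhi Φ ⟨P, hΦ⟩ := by
  ext x
  exact not_congr (RPhi.coneMem_transfer h hΦ hΨ x)

end TransferSpectrum

/-! ### Tensor multiples among powers, and supports -/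

section TensorPowers

variable {C : Type u} [Category.{v} C] [MonoidalCategory C]

instance (X : C) : (tensorPowers X).IsClosedUnderIsomorphisms where
  of_iso := fun e ⟨n, hn, ⟨e'⟩⟩ => ⟨n, hn, ⟨e.symm ≪≫ e'⟩⟩

lemma tensorPow_mem_of_mem {X Z : C} (hZ : tensorPowers X Z) :
    ∀ n : ℕ, tensorPowers X (tensorPow Z (n + 1))
  | 0 => hZ
  | n + 1 => ObjectProperty.prop_tensor (P₁ := tensorPowers X) (P₂ := tensorPowers X) hZ
      (tensorPow_mem_of_mem hZ n)

/-- One multiple of `A` itself is enough: `D^n ⊗ A^n ≅ (D ⊗ A)^n`, and a positive power of a member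
of the family is again a member. -/
lemma exists_tensor_mem_tensorPowers [SymmetricCategory C] {A B D : C}
    (h : tensorPowers B (D ⊗ A)) (Z : C) (hZ : tensorPowers A Z) :
    ∃ W, tensorPowers B (W ⊗ Z) := by
  obtain ⟨n, hn, ⟨e⟩⟩ := hZ
  obtain ⟨n, rfl⟩ := Nat.exists_eq_add_of_le' hn
  exact ⟨tensorPow D (n + 1), (tensorPowers B).prop_of_iso
    ((whiskerLeftIso _ e ≪≫ tensorPowTensor D A (n + 1)).symm) (tensorPow_mem_of_mem h n)⟩

/-- Supplies the inverse direction: moving the factors `Y` together gives `X^k ⊗ Y^k ≅ (X ⊗ Y)^k`.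
-/
lemma tensorPow_left_mem [SymmetricCategory C] (X Y : C) {k : ℕ} (hk : 1 ≤ k) :
    tensorPowers (X ⊗ Y) (tensorPow Y (k - 1) ⊗ (tensorPow X k ⊗ Y)) := by
  obtain ⟨k, rfl⟩ := Nat.exists_eq_add_of_le' hk
  exact ⟨k + 1, hk, ⟨β_ _ _ ≪≫ α_ _ _ _ ≪≫ whiskerLeftIso _ (β_ _ _ ≪≫ tensorPowAdd Y k 1) ≪≫
    tensorPowTensor X Y (k + 1)⟩⟩

variable [SymmetricCategory C] [Preadditive C] [HasZeroObject C] [HasShift C ℤ]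
  [∀ n : ℤ, (shiftFunctor C n).Additive] [Pretriangulated C]

lemma supp_tensor (X Y : C) : supp (X ⊗ Y) = supp X ∩ supp Y := by
  ext P
  exact ⟨fun h => ⟨fun hX => h (P.mem_tensor_right Y hX), fun hY => h (P.tensor_mem X hY)⟩,
    fun h hXY => (P.mem_or_mem hXY).elim h.1 h.2⟩

lemma supp_tensorPow (X : C) : ∀ n : ℕ, supp (tensorPow X (n + 1)) = supp X
  | 0 => rfl
  | n + 1 => (supp_tensor _ _).trans (by rw [supp_tensorPow X n, Set.inter_self])

end TensorPowers

end TTGeometry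

theorem mainTheorem11 {C : Type u} [Category.{v} C] [MonoidalCategory C] [SymmetricCategory C]
    [Preadditive C] [MonoidalPreadditive C] [HasZeroObject C] [HasShift C ℤ]
    [∀ n : ℤ, (shiftFunctor C n).Additive] [Pretriangulated C] [IsTriangulated C]
    [TTGeometry.TensorTriangulated C] (X Y : C) (k : ℕ) (hk : 1 ≤ k) :
    ∃ φ : TTGeometry.RObj (X ⊗ Y) ≃+* TTGeometry.RObj (TTGeometry.tensorPow X k ⊗ Y),
      (∀ (n : ℕ) (hn : 1 ≤ n)
        (f : TTGeometry.balancedEnd (TTGeometry.tensorPow (X ⊗ Y) n)),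
        φ (TTGeometry.cls (TTGeometry.tensorPow_mem (X ⊗ Y) hn) f) =
          TTGeometry.cls (TTGeometry.tensorPow_tensor_mem X Y hk hn)
            (TTGeometry.tensorOnLeft
              (TTGeometry.tensorPow (TTGeometry.tensorPow X (k - 1)) n) f)) ∧
      TTGeometry.supp (X ⊗ Y) = TTGeometry.supp (TTGeometry.tensorPow X k ⊗ Y) ∧
      ∀ (P : TTGeometry.Spc C) (h : P ∈ TTGeometry.supp (X ⊗ Y))
        (h' : P ∈ TTGeometry.supp (TTGeometry.tensorPow X k ⊗ Y)),
        PrimeSpectrum.comap (φ : TTGeometry.RObj (X ⊗ Y) →+*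
            TTGeometry.RObj (TTGeometry.tensorPow X k ⊗ Y))
          (TTGeometry.rho (TTGeometry.tensorPow X k ⊗ Y) ⟨P, h'⟩) =
        TTGeometry.rho (X ⊗ Y) ⟨P, h⟩ := by
  -- The case `n = 1` of the membership, in which both outer powers reduce to their bases: the
  -- multiplier is `X^{k-1}`.
  have hX := TTGeometry.exists_tensor_mem_tensorPowers
    (TTGeometry.tensorPow_tensor_mem X Y hk le_rfl)
  have hY := TTGeometry.exists_tensor_mem_tensorPowers (TTGeometry.tensorPow_left_mem X Y hk)
  refine ⟨TTGeometry.RPhi.transferEquiv hX hY, fun n hn f => ?_, ?_, fun P h h' => ?_⟩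
  -- The prescribed multiplier `(X^{k-1})^n` replaces the chosen one.
  · exact TTGeometry.RPhi.transfer_cls hX _ (TTGeometry.tensorPow_tensor_mem X Y hk hn) f
  -- Positivity of the exponent matters: `X^0` is the unit, whose support is in general larger than
  -- that of `X`.
  · obtain ⟨k, rfl⟩ := Nat.exists_eq_add_of_le' hk
    rw [TTGeometry.supp_tensor, TTGeometry.supp_tensor, TTGeometry.supp_tensorPow]
  · exact TTGeometry.comap_transferEquiv_rhoPhi hX hY (TTGeometry.supp_le_suppPhi _ h)
      (TTGeometry.supp_le_suppPhi _ h')
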